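/- Let $m\ge 1$ be an integer and let $F\in\mathbb{C}^{m\times m}$ be the DFT matrix with entries $F_{k,l}=\frac{1}{\sqrt m}e^{-2\pi i kl/m}$, $k,l\in\{1,\dots,m\}$. For $A\subseteq\{1,\dots,m\}$ let $D_A$ be the $m\times m$ diagonal matrix with $(D_A)_{i,i}=1$ for $i\in A$ and $(D_A)_{i,i}=0$ otherwise. For $P,Q\subseteq\{1,\dots,m\}$ let $$\Delta_{P,Q}(F)=\| D_P\,F D_Q F^{H}\|_{2}$$ be the operator norm of $D_P F D_Q F^{H}$ with respect to the Euclidean norm on $\mathbb{C}^m$. For $\lambda\in(0,m]$ define the circular Nyquist density $$\rho(P,\lambda)=\frac1\lambda\max_{r\in[0,m)}\bigl|\widetilde P\cap(r,r+\lambda)\bigr|,\qquad \widetilde P=P\cup\{m+p:p\in P\},$$ where $(r,r+\lambda)$ is the open interval. Let $P\subseteq\{1,\dots,m\}$ be arbitrary, let $l,n\in\{1,\dots,m\}$, and let $Q=\{l+1,\dots,l+n\}$, interpreted circularly in $\{1,\dots,m\}$ (that is, modulo $m$). Then $$\Delta_{P,Q}(F)\le\sqrt{\Bigl(\frac{\lambda(n-1)}{m}+1\Bigr)\rho(P,\lambda)}\qquad\text{for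 all }\lambda\in(0,m].$$ -/

import Mathlib

noncomputable section

namespace LargeSieve

/-- The index set `{1, …, m}`. -/
abbrev Idx (m : ℕ) : Type := ↥(Finset.Icc 1 m)

/-- The `m × m` DFT matrix, with entry `(1/√m) e^{-2πi kl/m}` at `k, l ∈ {1, …, m}`. -/
def dft (m : ℕ) : Matrix (Idx m) (Idx m) ℂ :=
  Matrix.of fun k l =>
    (1 / (Real.sqrt m : ℂ)) *
      Complex.exp (-2 * Real.pi * Complex.I * ((k : ℕ) : ℂ) * ((l : ℕ) : ℂ) / (m : ℂ))

/-- The diagonal matrix `D_A`, with diagonal entry `1` on `A` and `0` off `A`. -/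
def diagProj {m : ℕ} (A : Finset (Idx m)) : Matrix (Idx m) (Idx m) ℂ :=
  Matrix.diagonal fun i => if i ∈ A then 1 else 0

/-- `P_A(U) = U D_A Uᴴ`. -/
def proj {m : ℕ} (A : Finset (Idx m)) (U : Matrix (Idx m) (Idx m) ℂ) :
    Matrix (Idx m) (Idx m) ℂ :=
  U * diagProj A * U.conjTranspose

/-- `Δ_{P,Q}(U)`: the operator norm of `D_P P_Q(U)` on `ℂ^m` with the Euclidean norm. -/
def Delta {m : ℕ} (P Q : Finset (Idx m)) (U : Matrix (Idx m) (Idx m) ℂ) : ℝ :=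
  ‖Matrix.toEuclideanCLM (𝕜 := ℂ) (n := Idx m) (diagProj P * proj Q U)‖

/-- `{l+1, …, l+n}` interpreted circularly in `{1, …, m}`. -/
def circInterval (m l n : ℕ) : Finset (Idx m) :=
  Finset.univ.filter fun i => ∃ k ∈ Finset.Icc 1 n, (i : ℕ) ≡ l + k [MOD m]

/-- `P ∪ {m + p : p ∈ P}`, as a set of natural numbers. -/
def doubled {m : ℕ} (P : Finset (Idx m)) : Finset ℕ :=
  P.image (fun p : Idx m => (p : ℕ)) ∪ P.image (fun p : Idx m => m + (p : ℕ))

/-- The number of points of `P ∪ (m + P)` in the open interval `(r, r + lam)`. -/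
def openCount {m : ℕ} (P : Finset (Idx m)) (lam r : ℝ) : ℕ :=
  ((doubled P).filter fun p : ℕ => r < (p : ℝ) ∧ (p : ℝ) < r + lam).card

/-- The largest value of `openCount P lam r` over `r ∈ [0, m)`. -/
def maxOpenCount {m : ℕ} (P : Finset (Idx m)) (lam : ℝ) : ℕ :=
  sSup (openCount P lam '' Set.Ico (0 : ℝ) m)

/-- The supremum above is a maximum. -/
theorem isGreatest_maxOpenCount {m : ℕ} (hm : 1 ≤ m) (P : Finset (Idx m)) (lam : ℝ) :
    IsGreatest (openCount P lam '' Set.Ico (0 : ℝ) m) (maxOpenCount P lam) := by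
  have hne : (openCount P lam '' Set.Ico (0 : ℝ) m).Nonempty :=
    ⟨_, 0, ⟨le_refl _, by exact_mod_cast hm⟩, rfl⟩
  have hbdd : BddAbove (openCount P lam '' Set.Ico (0 : ℝ) m) := by
    refine ⟨(doubled P).card, ?_⟩
    rintro _ ⟨r, -, rfl⟩
    exact Finset.card_filter_le _ _
  exact ⟨Nat.sSup_mem hne hbdd, fun _ h => le_csSup hbdd h⟩

/-- The circular Nyquist density
`ρ(P, lam) = (1/lam) max_{r ∈ [0,m)} |(P ∪ (m + P)) ∩ (r, r + lam)|`. -/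
def nyquistDensity {m : ℕ} (P : Finset (Idx m)) (lam : ℝ) : ℝ :=
  (1 / lam) * (maxOpenCount P lam : ℝ)

end LargeSieve

end

/-! The DFT matrix `F` is unitary, so `y = Fᴴ v` has the norm of `v`. On a run of `n` consecutive
columns, row `p` of `F` applied to `y` is, up to a phase and the factor `1/√m`, an exponential sum
`∑ c_k e(-kp/m)` over `k < n`. With `N = maxOpenCount P lam`, the claim becomes the large sieve
bound `∑_{p ∈ P} |∑ c_k e(-kp/m)|² ≤ N (n - 1 + m/lam) ∑ |c_k|²`.

For `δ`-spaced points of `ℝ/ℤ`, duality (`sum_norm_sq_le_of_dual`) turns this into a bound for sums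
over the points. Expanding the square gives geometric sums, each a difference of two terms of the
kernel `csc π(x_r - x_s)`; Hilbert's inequality with constant `1/δ` then yields `W + 1/δ` for `W`
frequencies (`dual_largeSieve`).

Hilbert's inequality follows Montgomery and Vaughan: for an eigenvector `u` of the skew kernel `A`,
expand `‖Au‖²` using `csc α csc β = csc(β - α)(cot α - cot β)`. The column sums of `cot` cancel by
the eigenvalue equation, and only `∑ (csc² + 2|csc cot|) ≤ 1/δ²` is needed.

Finally, in the `m`-periodic extension of `P`, points `N` steps apart differ by at least `lam`
(`periodicEnum_gap`). Unrolling many periods and averaging over the `N` residue classes of indices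
(`sum_norm_sq_le_of_gap`) brings in the factor `N` and improves `n + 1/δ` to `n - 1 + 1/δ`. -/

open Finset ComplexConjugate
open scoped ComplexOrder

namespace LargeSieve

/-! ### Hilbert's inequality for abstract cosecant kernels -/

section Hilbert

variable {ι : Type*} [Fintype ι]

/-- A bound for a bilinear form with symmetric real coefficients. -/
theorem re_sum_sum_mul_conj_le {k : ι → ι → ℝ} (hk : ∀ r s, k s r = k r s) (u : ι → ℂ) :
    (∑ s, ∑ t, (k s t : ℂ) * (u s * conj (u t))).re ≤ ∑ s, (∑ t, |k s t|) * ‖u s‖ ^ 2 := by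
  have h1 : (∑ s, ∑ t, (k s t : ℂ) * (u s * conj (u t))).re ≤
      ∑ s, ∑ t, |k s t| * ((‖u s‖ ^ 2 + ‖u t‖ ^ 2) / 2) := by
    rw [Complex.re_sum]
    refine sum_le_sum fun s _ => ?_
    rw [Complex.re_sum]
    refine sum_le_sum fun t _ => ?_
    refine (Complex.re_le_norm _).trans ?_
    rw [norm_mul, norm_mul, Complex.norm_real, Real.norm_eq_abs, Complex.norm_conj]
    exact mul_le_mul_of_nonneg_left (by nlinarith [sq_nonneg (‖u s‖ - ‖u t‖)]) (abs_nonneg _)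
  refine h1.trans (le_of_eq ?_)
  have h2 : ∑ s, ∑ t, |k s t| * ‖u t‖ ^ 2 = ∑ s, ∑ t, |k s t| * ‖u s‖ ^ 2 := by
    rw [sum_comm]
    exact sum_congr rfl fun s _ => sum_congr rfl fun t _ => by rw [hk]
  have h3 : ∀ s t, |k s t| * ((‖u s‖ ^ 2 + ‖u t‖ ^ 2) / 2) =
      (|k s t| * ‖u s‖ ^ 2) / 2 + (|k s t| * ‖u t‖ ^ 2) / 2 := fun s t => by ring
  simp only [h3, sum_add_distrib, ← sum_div, h2, sum_mul]
  ring

variable [DecidableEq ι] {a b : ι → ι → ℝ}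

/-- The Gram matrix of the columns of `a`, for kernels obeying the addition law of
`a = csc` and `b = cot`. -/
theorem sum_mul_eq_of_cotangent_law (ha : ∀ r s, a s r = -a r s) (hb : ∀ r s, b s r = -b r s)
    (hab : ∀ r s t, r ≠ s → r ≠ t → s ≠ t → a r s * a r t = a s t * (b r s - b r t)) (s t : ι) :
    ∑ r, a r s * a r t = (if s = t then ∑ r, a s r ^ 2 else 0) +
      a s t * (∑ r, b r s - ∑ r, b r t + 2 * b s t) := by
  have ha0 : ∀ r, a r r = 0 := fun r => by linarith [ha r r]
  have hb0 : ∀ r, b r r = 0 := fun r => by linarith [hb r r]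
  by_cases hst : s = t
  · subst hst
    rw [if_pos rfl, ha0, zero_mul, add_zero]
    exact sum_congr rfl fun r _ => by rw [ha s r]; ring
  · rw [if_neg hst, zero_add]
    -- The law fails at `r = s` and `r = t`, where the left side is `0` and the right side is `-a s
    -- t * b s t`; the two corrections produce the term `2 * b s t`.
    have key : ∀ r, a r s * a r t = a s t * (b r s - b r t) +
        ((if r = s then a s t * b s t else 0) + (if r = t then a s t * b s t else 0)) := by
      intro r
      by_cases hrs : r = s
      · subst hrs
        simp [ha0, hb0, hst]
      · by_cases hrt : r = t
        · subst hrt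
          simp [ha0, hb0, hrs, hb s r]
        · simp [hrs, hrt, hab r s t hrs hrt hst]
    rw [sum_congr rfl fun r _ => key r, sum_add_distrib, sum_add_distrib, ← mul_sum,
      sum_sub_distrib, sum_ite_eq' univ s, sum_ite_eq' univ t]
    simp only [mem_univ, if_true]
    ring

/-- An eigenvalue bound for a skew-symmetric kernel obeying the cotangent law. -/
theorem norm_eigenvalue_sq_mul_le (ha : ∀ r s, a s r = -a r s) (hb : ∀ r s, b s r = -b r s)
    (hab : ∀ r s t, r ≠ s → r ≠ t → s ≠ t → a r s * a r t = a s t * (b r s - b r t))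
    {c : ℝ} (hc : ∀ r, ∑ s, (a r s ^ 2 + 2 * |a r s * b r s|) ≤ c ^ 2)
    {u : ι → ℂ} {β : ℂ} (hβ : conj β = -β) (hu : ∀ r, ∑ s, (a r s : ℂ) * u s = β * u r) :
    ‖β‖ ^ 2 * ∑ r, ‖u r‖ ^ 2 ≤ c ^ 2 * ∑ r, ‖u r‖ ^ 2 := by
  have hu' : ∀ r, ∑ s, (a r s : ℂ) * conj (u s) = -β * conj (u r) := by
    intro r
    have := congrArg conj (hu r)
    simpa [map_sum, hβ] using this
  set C : ι → ℝ := fun s => ∑ r, b r s with hC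
  -- Both halves equal `-β ∑ C s |u s|²`: sum over `t` first in one and over `s` first in the other,
  -- using the eigenvalue equation each time. This is where an eigenvector is needed.
  have hcross : ∑ s, ∑ t, (a s t : ℂ) * ((C s - C t : ℝ) : ℂ) * (u s * conj (u t)) = 0 := by
    have e1 : ∑ s, ∑ t, (a s t : ℂ) * (C s : ℂ) * (u s * conj (u t)) =
        ∑ s, -β * ((C s : ℂ) * (u s * conj (u s))) := by
      refine sum_congr rfl fun s _ => ?_
      calc _ = (C s : ℂ) * u s * ∑ t, (a s t : ℂ) * conj (u t) := by
            rw [mul_sum]; exact sum_congr rfl fun t _ => by ring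
        _ = _ := by rw [hu']; ring
    have e2 : ∑ s, ∑ t, (a s t : ℂ) * (C t : ℂ) * (u s * conj (u t)) =
        ∑ s, -β * ((C s : ℂ) * (u s * conj (u s))) := by
      rw [sum_comm]
      refine sum_congr rfl fun t _ => ?_
      calc _ = -((C t : ℂ) * conj (u t) * ∑ s, (a t s : ℂ) * u s) := by
            rw [mul_sum, ← sum_neg_distrib]
            exact sum_congr rfl fun s _ => by rw [ha t s]; push_cast; ring
        _ = _ := by rw [hu]; ring
    have e3 : ∀ s t, (a s t : ℂ) * ((C s - C t : ℝ) : ℂ) * (u s * conj (u t)) =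
        (a s t : ℂ) * (C s : ℂ) * (u s * conj (u t)) -
          (a s t : ℂ) * (C t : ℂ) * (u s * conj (u t)) := fun s t => by push_cast; ring
    simp only [e3, sum_sub_distrib]
    rw [e1, e2, sub_self]
  have hexp : ((‖β‖ ^ 2 * ∑ r, ‖u r‖ ^ 2 : ℝ) : ℂ) =
      ((∑ s, (∑ r, a s r ^ 2) * ‖u s‖ ^ 2 : ℝ) : ℂ) +
        ∑ s, ∑ t, ((2 * (a s t * b s t) : ℝ) : ℂ) * (u s * conj (u t)) := by
    calc ((‖β‖ ^ 2 * ∑ r, ‖u r‖ ^ 2 : ℝ) : ℂ)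
        = ∑ r, (∑ s, (a r s : ℂ) * u s) * ∑ t, (a r t : ℂ) * conj (u t) := by
          push_cast
          rw [mul_sum]
          refine sum_congr rfl fun r _ => ?_
          rw [hu, hu', ← hβ, ← Complex.mul_conj', ← Complex.mul_conj']
          ring
      _ = ∑ s, ∑ t, ((∑ r, a r s * a r t : ℝ) : ℂ) * (u s * conj (u t)) := by
          simp only [sum_mul_sum]
          rw [sum_comm]
          refine sum_congr rfl fun s _ => ?_
          rw [sum_comm]
          refine sum_congr rfl fun t _ => ?_
          push_cast
          rw [sum_mul]
          exact sum_congr rfl fun r _ => by ring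
      _ = ∑ s, ∑ t, ((if s = t then ((∑ r, a s r ^ 2 : ℝ) : ℂ) * (u s * conj (u t)) else 0) +
            (a s t : ℂ) * ((C s - C t : ℝ) : ℂ) * (u s * conj (u t)) +
            ((2 * (a s t * b s t) : ℝ) : ℂ) * (u s * conj (u t))) := by
          refine sum_congr rfl fun s _ => sum_congr rfl fun t _ => ?_
          rw [sum_mul_eq_of_cotangent_law ha hb hab, show ∑ r, b r s = C s from rfl,
            show ∑ r, b r t = C t from rfl]
          split_ifs <;> push_cast <;> ring
      _ = _ := by
          simp only [sum_add_distrib]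
          rw [hcross, add_zero]
          simp only [sum_ite_eq, mem_univ, if_true, Complex.mul_conj']
          push_cast
          rfl
  have hre := congrArg Complex.re hexp
  rw [Complex.add_re, Complex.ofReal_re, Complex.ofReal_re] at hre
  rw [hre]
  have hk := re_sum_sum_mul_conj_le (k := fun s t => 2 * (a s t * b s t))
    (fun r s => by rw [ha r s, hb r s]; ring) u
  refine (add_le_add_right hk _).trans ?_
  rw [← sum_add_distrib, mul_sum]
  refine sum_le_sum fun s _ => ?_
  rw [← add_mul, ← sum_add_distrib]
  refine mul_le_mul_of_nonneg_right ?_ (sq_nonneg _)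
  refine le_trans (le_of_eq (sum_congr rfl fun t _ => ?_)) (hc s)
  rw [abs_mul 2, abs_of_pos (two_pos : (0 : ℝ) < 2)]

/-- Hilbert's inequality for a skew-symmetric kernel obeying the cotangent law. -/
theorem re_hilbert_form_le (ha : ∀ r s, a s r = -a r s) (hb : ∀ r s, b s r = -b r s)
    (hab : ∀ r s t, r ≠ s → r ≠ t → s ≠ t → a r s * a r t = a s t * (b r s - b r t))
    {c : ℝ} (hc0 : 0 ≤ c) (hc : ∀ r, ∑ s, (a r s ^ 2 + 2 * |a r s * b r s|) ≤ c ^ 2) (u : ι → ℂ) :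
    (Complex.I * ∑ r, ∑ s, (a r s : ℂ) * (u s * conj (u r))).re ≤ c * ∑ r, ‖u r‖ ^ 2 := by
  -- The inequality says that the Hermitian matrix `c - iA` is positive semidefinite. An eigenvalue
  -- `κ` of it gives the eigenvalue `i(κ - c)` of `A`, so `|κ - c| ≤ c` and hence `κ ≥ 0`.
  set B : Matrix ι ι ℂ := Matrix.of fun r s => (if r = s then (c : ℂ) else 0) -
    Complex.I * (a r s : ℂ) with hBdef
  have hmul : ∀ (v : ι → ℂ) r, B.mulVec v r = (c : ℂ) * v r - Complex.I * ∑ s, (a r s : ℂ) * v s := by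
    intro v r
    simp [B, Matrix.mulVec, dotProduct, sub_mul, sum_sub_distrib, mul_sum, mul_assoc]
  have hB : B.IsHermitian := by
    ext r s
    simp only [B, Matrix.conjTranspose_apply, Matrix.of_apply, ha s r]
    by_cases h : r = s
    · simp [h]
    · simp [h, Ne.symm h]
  have hpos : B.PosSemidef := by
    rw [hB.posSemidef_iff_eigenvalues_nonneg]
    intro j
    set κ := hB.eigenvalues j with hκ
    set v : ι → ℂ := (hB.eigenvectorBasis j).ofLp with hv
    have hvec : ∀ r, ∑ s, (a r s : ℂ) * v s = (Complex.I * ((κ - c : ℝ) : ℂ)) * v r := by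
      intro r
      have h := congrFun (hB.mulVec_eigenvectorBasis j) r
      rw [hmul] at h
      have h' : (c : ℂ) * v r - Complex.I * ∑ s, (a r s : ℂ) * v s = (κ : ℂ) * v r := by
        simpa using h
      have hI := Complex.I_mul_I
      push_cast
      linear_combination Complex.I * h' + (∑ s, (a r s : ℂ) * v s) * hI
    have hnorm : ∑ r, ‖v r‖ ^ 2 = 1 := by
      rw [hv, ← EuclideanSpace.norm_sq_eq, hB.eigenvectorBasis.orthonormal.1 j, one_pow]
    have h := norm_eigenvalue_sq_mul_le ha hb hab hc (u := v) (β := Complex.I * ((κ - c : ℝ) : ℂ))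
      (by simp) hvec
    rw [hnorm, norm_mul, Complex.norm_I, Complex.norm_real, Real.norm_eq_abs, one_mul, sq_abs,
      mul_one, mul_one] at h
    have := abs_le_of_sq_le_sq' h hc0
    simpa using (by linarith [this.1] : 0 ≤ κ)
  have h := hpos.re_dotProduct_nonneg u
  have e : star u ⬝ᵥ B.mulVec u = ((c * ∑ r, ‖u r‖ ^ 2 : ℝ) : ℂ) -
      Complex.I * ∑ r, ∑ s, (a r s : ℂ) * (u s * conj (u r)) := by
    simp only [dotProduct, hmul, Pi.star_apply, RCLike.star_def]
    push_cast
    rw [mul_sum, mul_sum, ← sum_sub_distrib]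
    refine sum_congr rfl fun r _ => ?_
    rw [← Complex.mul_conj', mul_sub]
    congr 1
    · ring
    · rw [mul_sum, mul_sum, mul_sum]
      exact sum_congr rfl fun s _ => by ring
  rw [e] at h
  simpa only [RCLike.re_to_complex, Complex.sub_re, Complex.ofReal_re, sub_nonneg] using h

end Hilbert

/-! ### Trigonometric estimates -/

section Trigonometric

open Real

/-- The Taylor bounds `sin x ≥ x - x³/6` and `cos x ≤ 1 - x²/2 + x⁴/24` suffice: after substitution
both sides become `3x² - x⁴ + x⁶/12`. -/
theorem one_add_two_mul_cos_mul_sq_le {x : ℝ} (hx0 : 0 ≤ x) (hx2 : x ≤ 2) :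
    (1 + 2 * cos x) * x ^ 2 ≤ 3 * sin x ^ 2 := by
  have hsq : ∀ y : ℝ, 0 ≤ y → y ≤ 2 → (y - y ^ 3 / 6) ^ 2 ≤ sin y ^ 2 := by
    intro y h0 h2
    refine pow_le_pow_left₀ ?_ (sin_ge_sub_cube h0) 2
    nlinarith [mul_nonneg h0 (mul_nonneg (sub_nonneg.2 h2) h0), mul_nonneg h0 (sub_nonneg.2 h2)]
  have hcos : cos x ≤ 1 - x ^ 2 / 2 + x ^ 4 / 24 := by
    have h1 := hsq (x / 2) (by linarith) (by linarith)
    have h2 : cos x = 1 - 2 * sin (x / 2) ^ 2 := by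
      rw [show cos x = cos (2 * (x / 2)) by ring_nf, cos_two_mul]
      linarith [sin_sq_add_cos_sq (x / 2)]
    nlinarith [pow_nonneg hx0 6]
  have h1 := hsq x hx0 hx2
  nlinarith [mul_le_mul_of_nonneg_right hcos (sq_nonneg x)]

/-- The left side is invariant under `θ ↦ 1 - θ`, and the term of the nearer endpoint alone bounds
it. -/
theorem csc_sq_add_two_mul_abs_csc_mul_cot_le {θ : ℝ} (h0 : 0 < θ) (h1 : θ < 1) :
    (sin (π * θ))⁻¹ ^ 2 + 2 * |(sin (π * θ))⁻¹ * (cos (π * θ) / sin (π * θ))| ≤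
      3 / π ^ 2 * (1 / θ ^ 2 + 1 / (1 - θ) ^ 2) := by
  have half : ∀ t : ℝ, 0 < t → t ≤ 1 / 2 →
      (sin (π * t))⁻¹ ^ 2 + 2 * |(sin (π * t))⁻¹ * (cos (π * t) / sin (π * t))| ≤
        3 / π ^ 2 * (1 / t ^ 2) := by
    intro t ht0 ht
    have hx0 : 0 < π * t := by positivity
    have hx2 : π * t ≤ π / 2 := by nlinarith [pi_pos]
    have hs : 0 < sin (π * t) := sin_pos_of_pos_of_lt_pi hx0 (by linarith [pi_pos])
    have hc : 0 ≤ cos (π * t) := cos_nonneg_of_neg_pi_div_two_le_of_le (by linarith) hx2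
    rw [abs_of_nonneg (by positivity)]
    have e1 : (sin (π * t))⁻¹ ^ 2 + 2 * ((sin (π * t))⁻¹ * (cos (π * t) / sin (π * t))) =
        (1 + 2 * cos (π * t)) / sin (π * t) ^ 2 := by field_simp
    have e2 : 3 / π ^ 2 * (1 / t ^ 2) = 3 / (π * t) ^ 2 := by field_simp
    rw [e1, e2, div_le_div_iff₀ (by positivity) (by positivity)]
    exact one_add_two_mul_cos_mul_sq_le hx0.le (by linarith [pi_le_four])
  rcases le_total θ (1 / 2) with h | h
  · refine (half θ h0 h).trans (mul_le_mul_of_nonneg_left ?_ (by positivity))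
    linarith [show (0 : ℝ) ≤ 1 / (1 - θ) ^ 2 by positivity]
  · have := half (1 - θ) (by linarith) (by linarith)
    rw [show π * (1 - θ) = π - π * θ by ring, sin_pi_sub, cos_pi_sub, neg_div, mul_neg,
      abs_neg] at this
    refine this.trans (mul_le_mul_of_nonneg_left ?_ (by positivity))
    linarith [show (0 : ℝ) ≤ 1 / θ ^ 2 by positivity]

theorem csc_mul_csc_eq {A B : ℝ} (hA : sin A ≠ 0) (hB : sin B ≠ 0) (hAB : sin (B - A) ≠ 0) :
    (sin A)⁻¹ * (sin B)⁻¹ = (sin (B - A))⁻¹ * (cos A / sin A - cos B / sin B) := by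
  have : cos A / sin A - cos B / sin B = sin (B - A) / (sin A * sin B) := by
    rw [sin_sub]; field_simp
  rw [this]
  field_simp

theorem sum_one_div_sq_le {α : Type*} (s : Finset α) (φ : α → ℕ) (hφ : Set.InjOn φ s) :
    ∑ i ∈ s, 1 / (φ i : ℝ) ^ 2 ≤ π ^ 2 / 6 := by
  classical
  rw [← sum_image (f := fun k : ℕ => 1 / (k : ℝ) ^ 2) hφ]
  exact sum_le_hasSum _ (fun i _ => by positivity) hasSum_zeta_two

end Trigonometric

/-- The points `x 0, …, x (R - 1)` are in cyclic order on the circle `ℝ/ℤ`, with consecutive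
gaps of at least `δ` (up to accumulation). -/
def CyclicallySpaced {R : ℕ} (δ : ℝ) (x : Fin R → ℝ) : Prop :=
  ∀ i j : Fin R, i < j → δ * ((j : ℝ) - (i : ℝ)) ≤ x j - x i ∧
    δ * (R - ((j : ℝ) - (i : ℝ))) ≤ 1 - (x j - x i)

/-! ### Hilbert's inequality for well-spaced points -/

section WellSpaced

variable {R : ℕ} {δ : ℝ} {x : Fin R → ℝ}

theorem CyclicallySpaced.mem_Ioo (hδ : 0 < δ) (hx : CyclicallySpaced δ x) {i j : Fin R}
    (hij : i < j) : x j - x i ∈ Set.Ioo (0 : ℝ) 1 := by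
  obtain ⟨h1, h2⟩ := hx i j hij
  have hij' : (i : ℝ) < (j : ℝ) := by exact_mod_cast hij
  have hjR : (j : ℝ) < R := by exact_mod_cast j.2
  have hi0 : (0 : ℝ) ≤ (i : ℝ) := by positivity
  have := mul_pos hδ (sub_pos.2 hij')
  have := mul_pos hδ (by linarith : (0 : ℝ) < R - ((j : ℝ) - (i : ℝ)))
  exact ⟨by linarith, by linarith⟩

theorem CyclicallySpaced.sin_ne_zero (hδ : 0 < δ) (hx : CyclicallySpaced δ x) {i j : Fin R}
    (hij : i ≠ j) : Real.sin (Real.pi * (x i - x j)) ≠ 0 := by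
  have key : ∀ i j : Fin R, i < j → Real.sin (Real.pi * (x j - x i)) ≠ 0 := by
    intro i j h
    obtain ⟨h0, h1⟩ := hx.mem_Ioo hδ h
    exact (Real.sin_pos_of_pos_of_lt_pi (mul_pos Real.pi_pos h0)
      (by nlinarith [Real.pi_pos])).ne'
  rcases lt_or_gt_of_ne hij with h | h
  · have := key i j h
    rwa [← neg_sub, mul_neg, Real.sin_neg, neg_ne_zero]
  · exact key j i h

theorem CyclicallySpaced.sum_csc_sq_le (hδ : 0 < δ) (hx : CyclicallySpaced δ x) (r : Fin R) :
    ∑ s, ((Real.sin (Real.pi * (x r - x s)))⁻¹ ^ 2 +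
      2 * |(Real.sin (Real.pi * (x r - x s)))⁻¹ *
        (Real.cos (Real.pi * (x r - x s)) / Real.sin (Real.pi * (x r - x s)))|) ≤
      (1 / δ) ^ 2 := by
  -- `φ s` counts the cyclic steps from `s` forward to `r`. The two arcs between the points have
  -- lengths at least `δ φ` and `δ (R - φ)`, and both counts are injective in `s ≠ r`, so each sum
  -- is at most `ζ(2)`.
  set φ : Fin R → ℕ := fun s => if s < r then (r : ℕ) - s else R - ((s : ℕ) - r) with hφ
  have hφpos : ∀ s, s ≠ r → 0 < φ s ∧ φ s < R := by
    intro s hs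
    have h1 := s.2
    have h2 := r.2
    have h3 : (s : ℕ) ≠ r := fun h => hs (Fin.ext h)
    simp only [hφ, Fin.lt_def]
    split_ifs <;> omega
  have hφinj : ∀ s t, s ≠ r → t ≠ r → φ s = φ t → s = t := by
    intro s t hs ht h
    have h1 := s.2
    have h2 := r.2
    have h3 := t.2
    have h4 : (s : ℕ) ≠ r := fun h => hs (Fin.ext h)
    have h5 : (t : ℕ) ≠ r := fun h => ht (Fin.ext h)
    simp only [hφ, Fin.lt_def] at h
    apply Fin.ext
    split_ifs at h <;> omega
  have hmono : ∀ θ y : ℝ, 0 < y → δ * y ≤ θ → 1 / θ ^ 2 ≤ 1 / δ ^ 2 * (1 / y ^ 2) := by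
    intro θ y hy h
    have h0 : 0 < δ * y := mul_pos hδ hy
    calc 1 / θ ^ 2 ≤ 1 / (δ * y) ^ 2 :=
          one_div_le_one_div_of_le (by positivity) (pow_le_pow_left₀ h0.le h 2)
      _ = _ := by field_simp
  have hterm : ∀ s, s ≠ r → (Real.sin (Real.pi * (x r - x s)))⁻¹ ^ 2 +
      2 * |(Real.sin (Real.pi * (x r - x s)))⁻¹ *
        (Real.cos (Real.pi * (x r - x s)) / Real.sin (Real.pi * (x r - x s)))| ≤
      3 / (Real.pi ^ 2 * δ ^ 2) * (1 / (φ s : ℝ) ^ 2 + 1 / ((R - φ s : ℕ) : ℝ) ^ 2) := by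
    intro s hs
    have hp := hφpos s hs
    have c1 : (0 : ℝ) < φ s := by exact_mod_cast hp.1
    have c2 : (0 : ℝ) < ((R - φ s : ℕ) : ℝ) := by exact_mod_cast Nat.sub_pos_of_lt hp.2
    have e : 3 / (Real.pi ^ 2 * δ ^ 2) * (1 / (φ s : ℝ) ^ 2 + 1 / ((R - φ s : ℕ) : ℝ) ^ 2) =
        3 / Real.pi ^ 2 * (1 / δ ^ 2 * (1 / (φ s : ℝ) ^ 2) +
          1 / δ ^ 2 * (1 / ((R - φ s : ℕ) : ℝ) ^ 2)) := by
      have := Real.pi_ne_zero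
      field_simp
    rw [e]
    rcases lt_or_gt_of_ne hs with h | h
    · obtain ⟨h0, h1⟩ := hx.mem_Ioo hδ h
      obtain ⟨g1, g2⟩ := hx s r h
      refine (csc_sq_add_two_mul_abs_csc_mul_cot_le h0 h1).trans
        (mul_le_mul_of_nonneg_left ?_ (by positivity))
      have hle : (s : ℕ) ≤ r := h.le
      have e1 : (φ s : ℝ) = (r : ℝ) - (s : ℝ) := by
        simp only [hφ, if_pos h]
        push_cast [hle]; ring
      refine add_le_add (hmono _ _ c1 (by rw [e1]; exact g1)) (hmono _ _ c2 ?_)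
      rw [Nat.cast_sub hp.2.le, e1]
      exact g2
    · obtain ⟨h0, h1⟩ := hx.mem_Ioo hδ h
      obtain ⟨g1, g2⟩ := hx r s h
      rw [show x r - x s = -(x s - x r) by ring, mul_neg, Real.sin_neg, Real.cos_neg, inv_neg,
        div_neg, neg_mul_neg, neg_sq]
      refine (csc_sq_add_two_mul_abs_csc_mul_cot_le h0 h1).trans
        (mul_le_mul_of_nonneg_left ?_ (by positivity))
      have hle : (r : ℕ) ≤ s := h.le
      have hle' : (s : ℕ) - r ≤ R := (Nat.sub_le _ _).trans s.2.le
      have e1 : (φ s : ℝ) = R - ((s : ℝ) - (r : ℝ)) := by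
        simp only [hφ, if_neg h.not_gt]
        rw [Nat.cast_sub hle', Nat.cast_sub hle]
      rw [add_comm]
      refine add_le_add (hmono _ _ c1 (by rw [e1]; exact g2)) (hmono _ _ c2 ?_)
      rw [Nat.cast_sub hp.2.le, e1]
      linarith
  rw [← Finset.sum_erase_add _ _ (mem_univ r)]
  simp only [sub_self, mul_zero, Real.sin_zero, inv_zero, zero_mul, abs_zero, ne_eq,
    OfNat.ofNat_ne_zero, not_false_eq_true, zero_pow, add_zero]
  refine (sum_le_sum fun s hs => hterm s (ne_of_mem_erase hs)).trans ?_
  rw [← mul_sum, sum_add_distrib]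
  have s1 := sum_one_div_sq_le (univ.erase r) φ fun s hs t ht h =>
    hφinj s t (ne_of_mem_erase hs) (ne_of_mem_erase ht) h
  have s2 := sum_one_div_sq_le (univ.erase r) (fun s => R - φ s) fun s hs t ht h => by
    have hs' := ne_of_mem_erase hs
    have ht' := ne_of_mem_erase ht
    have := hφpos s hs'
    have := hφpos t ht'
    exact hφinj s t hs' ht' (by simp only at h; omega)
  -- The factor `3` is exactly compensated by `1/6 + 1/6`, leaving the constant `1/δ²`.
  calc _ ≤ 3 / (Real.pi ^ 2 * δ ^ 2) * (Real.pi ^ 2 / 6 + Real.pi ^ 2 / 6) :=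
        mul_le_mul_of_nonneg_left (add_le_add s1 s2) (by positivity)
    _ = _ := by
        have := Real.pi_ne_zero
        field_simp
        norm_num

/-- Hilbert's inequality with the kernel `csc (π (x r - x s))`. -/
theorem CyclicallySpaced.abs_re_csc_form_le (hδ : 0 < δ) (hx : CyclicallySpaced δ x)
    (u : Fin R → ℂ) :
    |(Complex.I * ∑ r, ∑ s, (((Real.sin (Real.pi * (x r - x s)))⁻¹ : ℝ) : ℂ) *
      (u s * conj (u r))).re| ≤ 1 / δ * ∑ r, ‖u r‖ ^ 2 := by
  have hneg : ∀ r s, Real.pi * (x s - x r) = -(Real.pi * (x r - x s)) := fun r s => by ring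
  have ha : ∀ r s, (Real.sin (Real.pi * (x s - x r)))⁻¹ =
      -(Real.sin (Real.pi * (x r - x s)))⁻¹ := fun r s => by
    rw [hneg, Real.sin_neg, inv_neg]
  have key : ∀ v : Fin R → ℂ,
      (Complex.I * ∑ r, ∑ s, (((Real.sin (Real.pi * (x r - x s)))⁻¹ : ℝ) : ℂ) *
        (v s * conj (v r))).re ≤ 1 / δ * ∑ r, ‖v r‖ ^ 2 := by
    refine re_hilbert_form_le
      (b := fun r s => Real.cos (Real.pi * (x r - x s)) / Real.sin (Real.pi * (x r - x s)))
      ha (fun r s => ?_) (fun r s t hrs hrt hst => ?_) (by positivity) (hx.sum_csc_sq_le hδ)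
    · rw [hneg, Real.sin_neg, Real.cos_neg, div_neg]
    · have e : Real.pi * (x s - x t) = Real.pi * (x r - x t) - Real.pi * (x r - x s) := by ring
      have h := hx.sin_ne_zero hδ hst
      rw [e] at h ⊢
      exact csc_mul_csc_eq (hx.sin_ne_zero hδ hrs) (hx.sin_ne_zero hδ hrt) h
  rw [abs_le]
  refine ⟨?_, key u⟩
  -- Conjugating `u` flips the sign of the form, by skew-symmetry, which gives the lower bound.
  have h := key fun r => conj (u r)
  simp only [Complex.norm_conj, Complex.conj_conj] at h
  have e : ∑ r, ∑ s, (((Real.sin (Real.pi * (x r - x s)))⁻¹ : ℝ) : ℂ) * (conj (u s) * u r) =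
      -∑ r, ∑ s, (((Real.sin (Real.pi * (x r - x s)))⁻¹ : ℝ) : ℂ) * (u s * conj (u r)) := by
    rw [sum_comm, ← sum_neg_distrib]
    refine sum_congr rfl fun s _ => ?_
    rw [← sum_neg_distrib]
    refine sum_congr rfl fun r _ => ?_
    rw [ha s r]
    push_cast
    ring
  rw [e, mul_neg, Complex.neg_re] at h
  linarith

end WellSpaced

/-! ### Duality and the large sieve inequality -/

/-- A bound for a matrix follows from the same bound for its transpose. -/
theorem sum_norm_sq_le_of_dual {ι κ : Type*} (s : Finset ι) (t : Finset κ) (E : ι → κ → ℂ) {C : ℝ}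
    (hC : 0 ≤ C)
    (h : ∀ u : ι → ℂ, ∑ k ∈ t, ‖∑ r ∈ s, u r * E r k‖ ^ 2 ≤ C * ∑ r ∈ s, ‖u r‖ ^ 2) (c : κ → ℂ) :
    ∑ r ∈ s, ‖∑ k ∈ t, c k * E r k‖ ^ 2 ≤ C * ∑ k ∈ t, ‖c k‖ ^ 2 := by
  set f : ι → ℂ := fun r => ∑ k ∈ t, c k * E r k with hf
  set S : ℝ := ∑ r ∈ s, ‖f r‖ ^ 2 with hS
  have hS0 : 0 ≤ S := sum_nonneg fun r _ => sq_nonneg _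
  have h1 : (S : ℂ) = ∑ k ∈ t, c k * ∑ r ∈ s, conj (f r) * E r k := by
    simp only [hS, mul_sum]
    push_cast
    rw [sum_comm]
    refine sum_congr rfl fun r _ => ?_
    rw [← Complex.mul_conj']
    nth_rewrite 1 [hf]
    rw [sum_mul]
    exact sum_congr rfl fun k _ => by ring
  have h2 : S ≤ ∑ k ∈ t, ‖c k‖ * ‖∑ r ∈ s, conj (f r) * E r k‖ := by
    calc S = ‖(S : ℂ)‖ := by rw [Complex.norm_real, Real.norm_of_nonneg hS0]
      _ ≤ _ := by
        rw [h1]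
        exact (norm_sum_le _ _).trans (le_of_eq (sum_congr rfl fun k _ => norm_mul _ _))
  have h3 := sum_mul_sq_le_sq_mul_sq t (fun k => ‖c k‖) fun k => ‖∑ r ∈ s, conj (f r) * E r k‖
  have h4 := h fun r => conj (f r)
  simp only [Complex.norm_conj] at h4
  have hc0 : 0 ≤ ∑ k ∈ t, ‖c k‖ ^ 2 := sum_nonneg fun k _ => sq_nonneg _
  have h5 : S ^ 2 ≤ (∑ k ∈ t, ‖c k‖ ^ 2) * (C * S) :=
    (pow_le_pow_left₀ hS0 h2 2).trans (h3.trans (mul_le_mul_of_nonneg_left h4 hc0))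
  rcases hS0.eq_or_lt with h0 | h0
  · rw [← h0]
    positivity
  · nlinarith

/-- The character `y ↦ e^{-2πiy}` of `ℝ/ℤ`. -/
noncomputable def negChar (y : ℝ) : ℂ := Complex.exp ((-(2 * Real.pi * y) : ℝ) * Complex.I)

theorem norm_negChar (y : ℝ) : ‖negChar y‖ = 1 := Complex.norm_exp_ofReal_mul_I _

theorem negChar_add (y z : ℝ) : negChar (y + z) = negChar y * negChar z := by
  rw [negChar, negChar, negChar, ← Complex.exp_add]
  congr 1
  push_cast
  ring

theorem negChar_natCast (k : ℕ) : negChar k = 1 := by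
  rw [negChar, Complex.exp_eq_one_iff]
  exact ⟨-k, by push_cast; ring⟩

theorem negChar_nat_mul (k : ℕ) (y : ℝ) : negChar (k * y) = negChar y ^ k := by
  rw [negChar, negChar, ← Complex.exp_nat_mul]
  congr 1
  push_cast
  ring

/-- With `ζ = e^{iα}`, `ω = e^{-iα}` and `σ = sin α`, the denominator `ζ² - 1` of the geometric sum
is `2iσζ`. -/
theorem sum_sq_pow_eq_of_sub_eq {ζ ω σ : ℂ} (hζω : ζ * ω = 1) (hd : ζ - ω = 2 * Complex.I * σ)
    (hσ : σ ≠ 0) (W : ℕ) :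
    ∑ k ∈ range W, (ζ ^ 2) ^ k = -(Complex.I / 2) * (σ⁻¹ * ((ζ ^ 2) ^ W * ω - ω)) := by
  have hζ0 : ζ ≠ 0 := left_ne_zero_of_mul_eq_one hζω
  have hq : ζ ^ 2 - 1 = 2 * Complex.I * σ * ζ := by linear_combination ζ * hd + hζω
  have hne : ζ ^ 2 - 1 ≠ 0 := by
    rw [hq]
    exact mul_ne_zero (mul_ne_zero (mul_ne_zero two_ne_zero Complex.I_ne_zero) hσ) hζ0
  rw [geom_sum_eq (sub_ne_zero.1 hne), div_eq_iff hne, hq]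
  have hσσ : σ⁻¹ * σ = 1 := inv_mul_cancel₀ hσ
  linear_combination ((ζ ^ 2) ^ W - 1) * (Complex.I ^ 2 * (ζ * ω) * hσσ +
    Complex.I ^ 2 * hζω + Complex.I_sq)

variable {R : ℕ} {δ : ℝ} {x : Fin R → ℝ}

/-- The dual form of the large sieve inequality. -/
theorem CyclicallySpaced.dual_largeSieve (hδ : 0 < δ) (hx : CyclicallySpaced δ x) (W : ℕ)
    (u : Fin R → ℂ) :
    ∑ k ∈ range W, ‖∑ r, u r * negChar (k * x r)‖ ^ 2 ≤ (W + 1 / δ) * ∑ r, ‖u r‖ ^ 2 := by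
  set z : Fin R → ℂ := fun r => negChar (x r / 2) with hz
  have hzn : ∀ r, ‖z r‖ = 1 := fun r => norm_negChar _
  have hzc : ∀ r, z r * conj (z r) = 1 := fun r => by
    rw [Complex.mul_conj', hzn]; norm_num
  have hzk : ∀ r (k : ℕ), negChar (k * x r) = (z r ^ 2) ^ k := fun r k => by
    have h : z r ^ 2 = negChar (x r) := by
      rw [← negChar_nat_mul]
      congr 1
      push_cast
      ring
    rw [negChar_nat_mul, h]
  set a : Fin R → Fin R → ℝ := fun r s => (Real.sin (Real.pi * (x r - x s)))⁻¹ with ha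
  have hsin : ∀ r s, z s * conj (z r) - conj (z s) * z r =
      2 * Complex.I * (Real.sin (Real.pi * (x r - x s)) : ℂ) := by
    intro r s
    have e1 : z s * conj (z r) = Complex.exp ((Real.pi * (x r - x s) : ℝ) * Complex.I) := by
      simp only [hz, negChar]
      rw [← Complex.exp_conj, ← Complex.exp_add]
      congr 1
      simp only [map_mul, Complex.conj_ofReal, Complex.conj_I]
      push_cast
      ring
    have e2 : conj (z s) * z r = Complex.exp (-((Real.pi * (x r - x s) : ℝ) : ℂ) * Complex.I) := by
      simp only [hz, negChar]
      rw [← Complex.exp_conj, ← Complex.exp_add]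
      congr 1
      simp only [map_mul, Complex.conj_ofReal, Complex.conj_I]
      push_cast
      ring
    rw [e1, e2, Complex.ofReal_sin, Complex.sin]
    linear_combination (Complex.exp ((Real.pi * (x r - x s) : ℝ) * Complex.I) -
      Complex.exp (-((Real.pi * (x r - x s) : ℝ) : ℂ) * Complex.I)) * Complex.I_sq
  -- Each of the two terms has phases that factor over `r` and `s`, hence can be absorbed into `u`
  -- without changing its norm. The diagonal causes no trouble because `a r r = 0⁻¹ = 0`.
  have hgeom : ∀ r s, ∑ k ∈ range W, (z s ^ 2) ^ k * conj ((z r ^ 2) ^ k) =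
      (if r = s then (W : ℂ) else 0) + -(Complex.I / 2) * ((a r s : ℂ) *
        ((z s ^ 2) ^ W * conj (z s) * (conj ((z r ^ 2) ^ W) * z r) - conj (z s) * z r)) := by
    intro r s
    have hterm : ∀ k, (z s ^ 2) ^ k * conj ((z r ^ 2) ^ k) = ((z s * conj (z r)) ^ 2) ^ k := by
      intro k
      simp only [map_pow]
      ring
    simp only [hterm]
    by_cases hrs : r = s
    · subst hrs
      simp [hzc, ha]
    · rw [if_neg hrs, zero_add]
      have hs := hx.sin_ne_zero hδ hrs
      have hs' : (Real.sin (Real.pi * (x r - x s)) : ℂ) ≠ 0 := by exact_mod_cast hs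
      have hζω : z s * conj (z r) * (conj (z s) * z r) = 1 := by
        linear_combination (z r * conj (z r)) * hzc s + hzc r
      rw [sum_sq_pow_eq_of_sub_eq hζω (hsin r s) hs']
      simp only [ha, map_pow]
      push_cast
      ring
  have hexp : ((∑ k ∈ range W, ‖∑ r, u r * negChar (k * x r)‖ ^ 2 : ℝ) : ℂ) =
      ((W * ∑ r, ‖u r‖ ^ 2 : ℝ) : ℂ) -
        1 / 2 * (Complex.I * ∑ r, ∑ s, (a r s : ℂ) * (u s * ((z s ^ 2) ^ W * conj (z s)) *
          conj (u r * ((z r ^ 2) ^ W * conj (z r))))) +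
        1 / 2 * (Complex.I * ∑ r, ∑ s, (a r s : ℂ) * (u s * conj (z s) *
          conj (u r * conj (z r)))) := by
    calc ((∑ k ∈ range W, ‖∑ r, u r * negChar (k * x r)‖ ^ 2 : ℝ) : ℂ)
        = ∑ k ∈ range W, ∑ r, ∑ s, u s * (z s ^ 2) ^ k * conj (u r * (z r ^ 2) ^ k) := by
          push_cast
          refine sum_congr rfl fun k _ => ?_
          simp only [hzk]
          rw [← Complex.mul_conj', map_sum, mul_comm, sum_mul_sum]
          exact sum_congr rfl fun r _ => sum_congr rfl fun s _ => mul_comm _ _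
      _ = ∑ r, ∑ s, u s * conj (u r) * ∑ k ∈ range W, (z s ^ 2) ^ k * conj ((z r ^ 2) ^ k) := by
          rw [sum_comm]
          refine sum_congr rfl fun r _ => ?_
          rw [sum_comm]
          refine sum_congr rfl fun s _ => ?_
          rw [mul_sum]
          refine sum_congr rfl fun k _ => ?_
          rw [map_mul]
          ring
      _ = ∑ r, ∑ s, ((if r = s then (W : ℂ) * (u s * conj (u r)) else 0) -
            1 / 2 * (Complex.I * ((a r s : ℂ) * (u s * ((z s ^ 2) ^ W * conj (z s)) *
              conj (u r * ((z r ^ 2) ^ W * conj (z r)))))) +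
            1 / 2 * (Complex.I * ((a r s : ℂ) * (u s * conj (z s) * conj (u r * conj (z r)))))) := by
          refine sum_congr rfl fun r _ => sum_congr rfl fun s _ => ?_
          rw [hgeom]
          simp only [map_mul, Complex.conj_conj]
          split_ifs <;> ring
      _ = _ := by
          simp only [sum_add_distrib, sum_sub_distrib, sum_ite_eq, mem_univ, if_true,
            Complex.mul_conj', ← mul_sum]
          push_cast
          rfl
  have h1 := hx.abs_re_csc_form_le hδ fun s => u s * ((z s ^ 2) ^ W * conj (z s))
  have h2 := hx.abs_re_csc_form_le hδ fun s => u s * conj (z s)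
  simp only [norm_mul, norm_pow, hzn, Complex.norm_conj, one_pow, mul_one] at h1 h2
  have hre := congrArg Complex.re hexp
  have hhalf : ∀ w : ℂ, (1 / 2 * w).re = 1 / 2 * w.re := fun w => by
    rw [show (1 / 2 : ℂ) = ((1 / 2 : ℝ) : ℂ) by push_cast; rfl, Complex.re_ofReal_mul]
  rw [Complex.add_re, Complex.sub_re, Complex.ofReal_re, Complex.ofReal_re, hhalf, hhalf] at hre
  rw [hre, add_mul]
  linarith [(abs_le.1 h1).1, (abs_le.1 h2).2]

/-- The large sieve inequality for exponential sums whose frequencies are multiples of `D`. -/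
theorem CyclicallySpaced.largeSieve (hδ : 0 < δ) (hx : CyclicallySpaced δ x) {D n : ℕ} (hD : 0 < D)
    (hn : 0 < n) (c : ℕ → ℂ) :
    ∑ r, ‖∑ k ∈ range n, c k * negChar (D * k * x r)‖ ^ 2 ≤
      (D * ((n : ℝ) - 1) + 1 + 1 / δ) * ∑ k ∈ range n, ‖c k‖ ^ 2 := by
  have hn1 : (1 : ℝ) ≤ n := by exact_mod_cast hn
  have hC : 0 ≤ D * ((n : ℝ) - 1) + 1 + 1 / δ := by
    have : 0 ≤ (n : ℝ) - 1 := by linarith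
    positivity
  refine sum_norm_sq_le_of_dual univ (range n) (fun r k => negChar (D * k * x r)) hC
    (fun u => ?_) c
  -- The multiples `D * k` with `k < n` lie among the first `D (n - 1) + 1` frequencies; the other
  -- frequencies contribute nonnegative terms.
  have h := hx.dual_largeSieve hδ (D * (n - 1) + 1) u
  have hcast : ((D * (n - 1) + 1 : ℕ) : ℝ) = D * ((n : ℝ) - 1) + 1 := by
    push_cast [Nat.cast_sub hn]
    ring
  rw [hcast] at h
  refine le_trans ?_ h
  have hinj : Set.InjOn (fun k => D * k) (range n : Set ℕ) := fun i _ j _ hij =>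
    Nat.eq_of_mul_eq_mul_left hD hij
  have himg : ∑ k ∈ range n, ‖∑ r, u r * negChar (D * k * x r)‖ ^ 2 =
      ∑ j ∈ (range n).image fun k => D * k, ‖∑ r, u r * negChar (j * x r)‖ ^ 2 := by
    rw [sum_image hinj]
    push_cast
    rfl
  rw [himg]
  refine sum_le_sum_of_subset_of_nonneg ?_ fun _ _ _ => sq_nonneg _
  intro j hj
  obtain ⟨k, hk, rfl⟩ := mem_image.1 hj
  rw [mem_range] at hk ⊢
  exact Nat.lt_succ_of_le (Nat.mul_le_mul_left _ (by omega))

/-! ### Periodic enumeration of a finite set -/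

section Enumeration

/-- The increasing enumeration of the `m`-periodic extension of `S`, starting at `min S`. -/
noncomputable def periodicEnum (m : ℕ) (S : Finset ℕ) (hS : 0 < S.card) (i : ℕ) : ℕ :=
  S.orderEmbOfFin rfl ⟨i % S.card, Nat.mod_lt _ hS⟩ + m * (i / S.card)

variable {m : ℕ} {S : Finset ℕ} (hS : 0 < S.card)

theorem periodicEnum_add_card (i : ℕ) :
    periodicEnum m S hS (i + S.card) = periodicEnum m S hS i + m := by
  simp only [periodicEnum, Nat.add_mod_right, Nat.add_div_right i hS]
  ring

theorem periodicEnum_add_card_mul (i k : ℕ) :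
    periodicEnum m S hS (i + S.card * k) = periodicEnum m S hS i + m * k := by
  induction k with
  | zero => simp
  | succ k ih => rw [Nat.mul_succ, ← add_assoc, periodicEnum_add_card, ih]; ring

theorem periodicEnum_of_lt {i : ℕ} (hi : i < S.card) :
    periodicEnum m S hS i = S.orderEmbOfFin rfl ⟨i, hi⟩ := by
  simp [periodicEnum, Nat.mod_eq_of_lt hi, Nat.div_eq_of_lt hi]

theorem periodicEnum_mem {i : ℕ} (hi : i < S.card) : periodicEnum m S hS i ∈ S := by
  rw [periodicEnum_of_lt hS hi]
  exact S.orderEmbOfFin_mem rfl _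

theorem periodicEnum_strictMono (hSm : S ⊆ Icc 1 m) : StrictMono (periodicEnum m S hS) := by
  intro i j hij
  have hmem : ∀ k, S.orderEmbOfFin rfl k ∈ Icc 1 m := fun k => hSm (S.orderEmbOfFin_mem rfl k)
  unfold periodicEnum
  rcases (Nat.div_le_div_right hij.le : i / S.card ≤ j / S.card).eq_or_lt with h | h
  · rw [h]
    refine Nat.add_lt_add_right ((S.orderEmbOfFin rfl).strictMono ?_) _
    rw [Fin.lt_def]
    have h1 := Nat.div_add_mod i S.card
    have h2 := Nat.div_add_mod j S.card
    rw [h] at h1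
    simp only
    omega
  · have h1 := (mem_Icc.1 (hmem ⟨i % S.card, Nat.mod_lt _ hS⟩)).2
    have h2 := (mem_Icc.1 (hmem ⟨j % S.card, Nat.mod_lt _ hS⟩)).1
    have h3 : m * (i / S.card) + m ≤ m * (j / S.card) := by
      rw [← Nat.mul_succ]
      exact Nat.mul_le_mul_left _ h
    omega

theorem sum_periodicEnum {β : Type*} [AddCommMonoid β] (f : ℕ → β) :
    ∑ i ∈ range S.card, f (periodicEnum m S hS i) = ∑ p ∈ S, f p := by
  rw [Finset.sum_range]
  have h : ∀ i : Fin S.card, periodicEnum m S hS i = S.orderEmbOfFin rfl i := fun i =>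
    periodicEnum_of_lt hS i.2
  simp only [h]
  conv_rhs => rw [← S.map_orderEmbOfFin_univ rfl, sum_map]
  rfl

end Enumeration

/-! ### The sieve for sequences with `N`-step gaps -/

theorem sum_range_mul_eq {β : Type*} [AddCommMonoid β] (g : ℕ → β) (A B : ℕ) :
    ∑ t ∈ range (A * B), g t = ∑ i ∈ range A, ∑ j ∈ range B, g (i * B + j) := by
  induction A with
  | zero => simp
  | succ A ih => rw [sum_range_succ, Nat.succ_mul, sum_range_add, ih]

theorem add_mul_le_of_add_le {q : ℕ → ℕ} {N : ℕ} {lam : ℝ} (hgap : ∀ i, (q i : ℝ) + lam ≤ q (i + N))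
    (i k : ℕ) : (q i : ℝ) + k * lam ≤ q (i + k * N) := by
  induction k with
  | zero => simp
  | succ k ih =>
    have := hgap (i + k * N)
    rw [Nat.succ_mul, ← add_assoc]
    push_cast
    linarith

/-- The large sieve inequality for the points of one period of a sequence whose `N`-step gaps are
at least `lam`. -/
theorem sum_norm_sq_le_of_gap {q : ℕ → ℕ} {m M N n : ℕ} {lam : ℝ} (hlam : 0 < lam) (hm : 0 < m)
    (hN : 0 < N) (hn : 0 < n) (hper : ∀ i k, q (i + M * k) = q i + m * k)
    (hgap : ∀ i, (q i : ℝ) + lam ≤ q (i + N)) (c : ℕ → ℂ) :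
    ∑ i ∈ range M, ‖∑ k ∈ range n, c k * negChar (k * q i / m)‖ ^ 2 ≤
      N * ((n : ℝ) - 1 + m / lam) * ∑ k ∈ range n, ‖c k‖ ^ 2 := by
  set g : ℕ → ℝ := fun i => ‖∑ k ∈ range n, c k * negChar (k * q i / m)‖ ^ 2 with hg
  set C : ℝ := ∑ k ∈ range n, ‖c k‖ ^ 2 with hC
  have hC0 : 0 ≤ C := sum_nonneg fun _ _ => sq_nonneg _
  have hm' : (0 : ℝ) < m := by exact_mod_cast hm
  have hN' : (0 : ℝ) < N := by exact_mod_cast hN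
  have hgper : ∀ i k, g (i + M * k) = g i := by
    intro i k
    simp only [hg, hper]
    congr 2
    refine sum_congr rfl fun t _ => ?_
    have : (t : ℝ) * ((q i + m * k : ℕ) : ℝ) / m = t * q i / m + ((t * k : ℕ) : ℝ) := by
      push_cast
      field_simp
    rw [this, negChar_add, negChar_natCast, mul_one]
  -- Unroll `N * T` periods onto a circle of length `m * N * T`. The factor `N` makes every residue
  -- class of indices modulo `N` close up after `M * T` points. The frequencies become multiples of
  -- `D = N * T`, so after division by `N * T` the surplus `1` in the sieve constant costs only `C /
  -- T`.
  have hT : ∀ T : ℕ, 0 < T →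
      ∑ i ∈ range M, g i ≤ N * ((n : ℝ) - 1 + m / lam) * C + C * (1 / T) := by
    intro T hT0
    have hT' : (0 : ℝ) < T := by exact_mod_cast hT0
    have hL : (0 : ℝ) < m * N * T := by positivity
    have hrow : ∀ j, ∑ i ∈ range (M * T), g (i * N + j) ≤
        ((N * T : ℕ) * ((n : ℝ) - 1) + 1 + 1 / (lam / (m * N * T))) * C := by
      intro j
      have hsp : CyclicallySpaced (R := M * T) (lam / (m * N * T))
          fun i => (q (i * N + j) : ℝ) / (m * N * T) := by
        intro i k hik
        have hik' : (i : ℕ) ≤ k := hik.le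
        obtain ⟨d, hd⟩ := Nat.exists_eq_add_of_le hik'
        obtain ⟨d', hd'⟩ := Nat.exists_eq_add_of_le k.2.le
        have hMT : ((M * T : ℕ) : ℝ) = k + d' := by exact_mod_cast hd'
        have hkd : (k : ℝ) = (i : ℝ) + d := by exact_mod_cast hd
        have g1 := add_mul_le_of_add_le hgap (i * N + j) d
        rw [show (i : ℕ) * N + j + d * N = k * N + j by rw [hd]; ring] at g1
        -- The complementary arc: `d' + i = R - (k - i)` steps lead from point `k` to point `i` one
        -- turn later.
        have g2 := add_mul_le_of_add_le hgap (k * N + j) (d' + i)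
        rw [show (k : ℕ) * N + j + (d' + i) * N = i * N + j + M * (T * N) by
          have h : M * T * N = (k + d') * N := congrArg (· * N) hd'
          linarith, hper] at g2
        push_cast at g2
        constructor
        · rw [← sub_div, div_mul_eq_mul_div]
          refine div_le_div_of_nonneg_right ?_ hL.le
          rw [hkd]
          linarith
        · rw [← sub_div, div_mul_eq_mul_div, div_le_iff₀ hL, sub_mul, div_mul_cancel₀ _ hL.ne',
            hMT, hkd]
          rw [hkd] at *
          nlinarith
      have h := hsp.largeSieve (by positivity) (Nat.mul_pos hN hT0) hn c
      rw [Finset.sum_range]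
      refine le_trans (le_of_eq (sum_congr rfl fun i _ => ?_)) h
      simp only [hg]
      congr 2
      refine sum_congr rfl fun k _ => ?_
      congr 2
      push_cast
      field_simp
    have hsum : ∑ j ∈ range N, ∑ i ∈ range (M * T), g (i * N + j) =
        (N * T : ℝ) * ∑ i ∈ range M, g i := by
      rw [sum_comm, ← sum_range_mul_eq, show M * T * N = (T * N) * M by ring, sum_range_mul_eq]
      have : ∀ i j, g (i * M + j) = g j := fun i j => by
        rw [add_comm, mul_comm, hgper]
      simp only [this, sum_const, card_range, nsmul_eq_mul]
      push_cast
      ring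
    have h := sum_le_sum fun j (_ : j ∈ range N) => hrow j
    rw [hsum, sum_const, card_range, nsmul_eq_mul] at h
    have hNT : (0 : ℝ) < N * T := by positivity
    refine le_of_mul_le_mul_left (h.trans (le_of_eq ?_)) hNT
    push_cast
    field_simp
    ring
  refine le_of_forall_pos_le_add fun ε hε => ?_
  obtain ⟨T, hT1⟩ := exists_nat_gt (C / ε)
  have hTpos : (0 : ℝ) < T := lt_of_le_of_lt (by positivity) hT1
  refine (hT T (by exact_mod_cast hTpos)).trans (add_le_add_right ?_ _)
  rw [mul_one_div, div_le_iff₀ hTpos]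
  rw [div_lt_iff₀ hε] at hT1
  linarith

/-- Otherwise the `N + 1` points from index `i` to index `i + N` would fit in one open interval of
length `lam`, against the maximality of `N`. -/
theorem periodicEnum_gap {m : ℕ} {P : Finset (Idx m)} {lam : ℝ} (hm : 0 < m) (hlam : lam ≤ m)
    (hS : 0 < (P.image fun p : Idx m => (p : ℕ)).card) (i : ℕ) :
    (periodicEnum m _ hS i : ℝ) + lam ≤ periodicEnum m _ hS (i + maxOpenCount P lam) := by
  set S := P.image fun p : Idx m => (p : ℕ) with hSdef
  set q := periodicEnum m S hS with hq
  set N := maxOpenCount P lam with hN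
  have hSm : S ⊆ Icc 1 m := fun p hp => by
    obtain ⟨p, -, rfl⟩ := mem_image.1 hp
    exact p.2
  have hmono := periodicEnum_strictMono hS hSm
  have main : ∀ i, i < S.card → (q i : ℝ) + lam ≤ q (i + N) := by
    intro i hi
    by_contra! hlt
    have hiS := periodicEnum_mem (m := m) hS hi
    have hi1 := mem_Icc.1 (hSm hiS)
    -- Because `lam ≤ m`, the run is shorter than a period, so it stays within the two copies of `P`
    -- in `doubled P`.
    have hNM : i + N < i + S.card := by
      refine hmono.lt_iff_lt.1 ?_
      rw [periodicEnum_add_card]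
      have : (q (i + N) : ℝ) < ((q i + m : ℕ) : ℝ) := by push_cast; linarith
      exact_mod_cast this
    have h1 : (1 : ℝ) ≤ q i := by exact_mod_cast hi1.1
    have h2 : (q i : ℝ) ≤ m := by exact_mod_cast hi1.2
    -- Starting at `q i - ε` puts `q i` inside the open interval. Since `1 ≤ q i ≤ m`, taking `0 < ε
    -- < 1` keeps the start in `[0, m)`, and `ε` below the slack keeps `q (i + N)` inside.
    obtain ⟨ε, hε0, hε⟩ := exists_between (lt_min one_pos (sub_pos.2 hlt))
    have hε1 := hε.trans_le (min_le_left _ _)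
    have hε2 := hε.trans_le (min_le_right _ _)
    have hcount : openCount P lam (q i - ε) ≤ N :=
      (isGreatest_maxOpenCount hm P lam).2 ⟨_, ⟨by linarith, by linarith⟩, rfl⟩
    have hsub : (Icc i (i + N)).image q ⊆
        (doubled P).filter fun p : ℕ => (q i : ℝ) - ε < p ∧ (p : ℝ) < q i - ε + lam := by
      intro p hp
      obtain ⟨k, hk, rfl⟩ := mem_image.1 hp
      rw [mem_Icc] at hk
      have k1 : (q i : ℝ) ≤ q k := by exact_mod_cast hmono.monotone hk.1
      have k2 : (q k : ℝ) ≤ q (i + N) := by exact_mod_cast hmono.monotone hk.2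
      refine mem_filter.2 ⟨?_, by linarith, by linarith⟩
      rw [doubled, mem_union]
      rcases lt_or_ge k S.card with hkS | hkS
      · exact Or.inl (periodicEnum_mem hS hkS)
      · right
        obtain ⟨d, rfl⟩ := Nat.exists_eq_add_of_le' hkS
        have hd := periodicEnum_mem (m := m) hS (show d < S.card by omega)
        obtain ⟨p, hp, hpd⟩ := mem_image.1 hd
        refine mem_image.2 ⟨p, hp, ?_⟩
        rw [hq, periodicEnum_add_card, hpd, add_comm]
    have hcard := card_le_card hsub
    rw [card_image_of_injective _ hmono.injective, Nat.card_Icc] at hcard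
    have : i + N + 1 - i ≤ N := hcard.trans hcount
    omega
  have hsplit := Nat.mod_add_div i S.card
  have h := main (i % S.card) (Nat.mod_lt _ hS)
  have e1 : q i = q (i % S.card) + m * (i / S.card) := by
    conv_lhs => rw [← hsplit]
    exact periodicEnum_add_card_mul hS _ _
  have e2 : q (i + N) = q (i % S.card + N) + m * (i / S.card) := by
    conv_lhs => rw [← hsplit, add_right_comm]
    exact periodicEnum_add_card_mul hS _ _
  rw [e1, e2]
  push_cast
  linarith

/-- The large sieve inequality for a set of given circular Nyquist density. -/
theorem sum_norm_sq_le_maxOpenCount {m n : ℕ} (P : Finset (Idx m)) {lam : ℝ} (hm : 0 < m)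
    (hn : 0 < n) (hlam0 : 0 < lam) (hlam : lam ≤ m) (c : ℕ → ℂ) :
    ∑ p ∈ P, ‖∑ k ∈ range n, c k * negChar (k * (p : ℕ) / m)‖ ^ 2 ≤
      maxOpenCount P lam * ((n : ℝ) - 1 + m / lam) * ∑ k ∈ range n, ‖c k‖ ^ 2 := by
  have hn1 : 0 ≤ (n : ℝ) - 1 := by
    have : (1 : ℝ) ≤ n := by exact_mod_cast hn
    linarith
  rcases P.eq_empty_or_nonempty with rfl | hP
  · rw [sum_empty]
    positivity
  · have hS : 0 < (P.image fun p : Idx m => (p : ℕ)).card := (hP.image _).card_pos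
    have hgap := periodicEnum_gap (P := P) hm hlam hS
    have hN : 0 < maxOpenCount P lam := by
      rw [Nat.pos_iff_ne_zero]
      intro h0
      have := hgap 0
      rw [h0] at this
      linarith
    have h := sum_norm_sq_le_of_gap hlam0 hm hN hn (periodicEnum_add_card_mul hS) hgap c
    rw [sum_periodicEnum (m := m) hS
      (fun p : ℕ => ‖∑ k ∈ range n, c k * negChar (k * p / m)‖ ^ 2),
      sum_image fun a _ b _ hab => Subtype.ext hab] at h
    exact h

/-! ### The DFT matrix and reduction to exponential sums -/

theorem dft_apply {m : ℕ} (k l : Idx m) :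
    dft m k l = (1 / (Real.sqrt m : ℂ)) * negChar ((k : ℕ) * (l : ℕ) / m) := by
  rw [dft, Matrix.of_apply, negChar]
  congr 2
  push_cast
  ring

theorem conj_negChar (y : ℝ) : conj (negChar y) = negChar (-y) := by
  rw [negChar, negChar, ← Complex.exp_conj]
  congr 1
  simp only [map_mul, Complex.conj_ofReal, Complex.conj_I]
  push_cast
  ring

theorem negChar_sub_div_ne_one {m : ℕ} {k l : Idx m} (hkl : k ≠ l) :
    negChar ((((k : ℕ) : ℝ) - (l : ℕ)) / m) ≠ 1 := by
  intro h
  rw [negChar, Complex.exp_eq_one_iff] at h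
  obtain ⟨z, hz⟩ := h
  have hk := mem_Icc.1 k.2
  have hl := mem_Icc.1 l.2
  have hm : (m : ℝ) ≠ 0 := by
    have : m ≠ 0 := by omega
    exact_mod_cast this
  have h1 : ((-(2 * Real.pi * ((((k : ℕ) : ℝ) - (l : ℕ)) / m)) : ℝ) : ℂ) =
      ((z * (2 * Real.pi) : ℝ) : ℂ) := by
    refine mul_right_cancel₀ Complex.I_ne_zero (hz.trans ?_)
    push_cast
    ring
  have h2 := Complex.ofReal_injective h1
  have h3 : ((k : ℕ) : ℝ) - (l : ℕ) = -z * m := by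
    have hpi := Real.pi_ne_zero
    field_simp at h2
    linarith
  have h4 : ((k : ℕ) : ℤ) - (l : ℕ) = -z * m := by exact_mod_cast h3
  have h5 : ((k : ℕ) : ℤ) - (l : ℕ) = 0 :=
    Int.eq_zero_of_abs_lt_dvd (m := m) ⟨-z, by rw [h4]; ring⟩ (by rw [abs_lt]; constructor <;> omega)
  exact hkl (Subtype.ext (by omega))

theorem dft_mul_conjTranspose (m : ℕ) : dft m * (dft m).conjTranspose = 1 := by
  ext k l
  have hk := mem_Icc.1 k.2
  have hm : 0 < m := by omega
  have hm' : (m : ℂ) ≠ 0 := by exact_mod_cast hm.ne'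
  have hsqrt : (1 / (Real.sqrt m : ℂ)) * (1 / (Real.sqrt m : ℂ)) = 1 / m := by
    rw [div_mul_div_comm, one_mul, ← Complex.ofReal_mul, Real.mul_self_sqrt (Nat.cast_nonneg m),
      Complex.ofReal_natCast]
  set ω : ℂ := negChar ((((k : ℕ) : ℝ) - (l : ℕ)) / m) with hω
  have hterm : ∀ j : Idx m, dft m k j * conj (dft m l j) = 1 / m * ω ^ (j : ℕ) := by
    intro j
    rw [dft_apply, dft_apply, map_mul, conj_negChar, hω, ← negChar_nat_mul, ← hsqrt]
    have : conj (1 / (Real.sqrt m : ℂ)) = 1 / (Real.sqrt m : ℂ) := by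
      simp [Complex.conj_ofReal]
    rw [this, mul_mul_mul_comm, ← negChar_add]
    congr 2
    ring
  rw [Matrix.mul_apply]
  simp only [Matrix.conjTranspose_apply, RCLike.star_def, hterm]
  rw [← mul_sum, Finset.sum_coe_sort (Icc 1 m) fun j => ω ^ j]
  by_cases hkl : k = l
  · have : ω = 1 := by
      rw [hω, hkl, sub_self, zero_div]
      exact_mod_cast negChar_natCast 0
    rw [this, hkl, Matrix.one_apply_eq]
    simp [hm']
  · rw [Matrix.one_apply_ne hkl]
    have h1 : ω ≠ 1 := negChar_sub_div_ne_one hkl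
    have h2 : ω ^ m = 1 := by
      have hmr : (m : ℝ) ≠ 0 := by exact_mod_cast hm.ne'
      rw [hω, ← negChar_nat_mul, mul_div_cancel₀ _ hmr, sub_eq_add_neg, negChar_add,
        ← conj_negChar, negChar_natCast, negChar_natCast]
      simp
    rw [← Finset.Ico_add_one_right_eq_Icc, geom_sum_Ico h1 (by omega), pow_succ, h2, one_mul,
      pow_one, sub_self, zero_div, mul_zero]

theorem sum_norm_sq_conjTranspose_dft_mulVec {m : ℕ} (v : Idx m → ℂ) :
    ∑ q, ‖(dft m).conjTranspose.mulVec v q‖ ^ 2 = ∑ q, ‖v q‖ ^ 2 := by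
  have h : star ((dft m).conjTranspose.mulVec v) ⬝ᵥ (dft m).conjTranspose.mulVec v =
      star v ⬝ᵥ v := by
    rw [Matrix.star_mulVec, Matrix.conjTranspose_conjTranspose, ← Matrix.dotProduct_mulVec,
      Matrix.mulVec_mulVec, dft_mul_conjTranspose, Matrix.one_mulVec]
  simp only [dotProduct, Pi.star_apply, RCLike.star_def, Complex.conj_mul'] at h
  exact_mod_cast h

theorem circInterval_eq_image {m l n : ℕ} (hm : 0 < m) :
    circInterval m l n = (range n).image fun k =>
      (⟨(l + k) % m + 1, mem_Icc.2 ⟨by omega, Nat.mod_lt _ hm⟩⟩ : Idx m) := by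
  ext i
  have hi := mem_Icc.1 i.2
  simp only [circInterval, mem_filter, mem_univ, true_and, mem_image, mem_range, mem_Icc]
  constructor
  · rintro ⟨k, ⟨hk1, hkn⟩, hk⟩
    refine ⟨k - 1, by omega, Subtype.ext ?_⟩
    obtain ⟨k, rfl⟩ := Nat.exists_eq_add_of_le' hk1
    obtain ⟨i', hi'⟩ := Nat.exists_eq_add_of_le' hi.1
    rw [hi', ← add_assoc] at hk
    have h := Nat.ModEq.add_right_cancel' 1 hk
    simp only [Nat.add_sub_cancel]
    rw [hi', ← h, Nat.mod_eq_of_lt (by omega)]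
  · rintro ⟨k, hk, rfl⟩
    refine ⟨k + 1, ⟨by omega, by omega⟩, ?_⟩
    simp only [← add_assoc]
    exact (Nat.mod_modEq _ _).add_right 1

theorem injOn_circular {m l n : ℕ} (hm : 0 < m) (hn : n ≤ m) :
    Set.InjOn (fun k => (⟨(l + k) % m + 1, mem_Icc.2 ⟨by omega, Nat.mod_lt _ hm⟩⟩ : Idx m))
      (range n : Set ℕ) := by
  intro i hi j hj h
  have h1 : (l + i) % m = (l + j) % m := Nat.succ_injective (congrArg Subtype.val h)
  have h2 : i ≡ j [MOD m] := Nat.ModEq.add_left_cancel' l h1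
  simp only [coe_range, Set.mem_Iio] at hi hj
  exact Nat.ModEq.eq_of_lt_of_lt h2 (by omega) (by omega)

theorem diagProj_mul_proj_mulVec {m : ℕ} (P Q : Finset (Idx m)) (U : Matrix (Idx m) (Idx m) ℂ)
    (v : Idx m → ℂ) (p : Idx m) :
    (diagProj P * proj Q U).mulVec v p =
      if p ∈ P then ∑ q ∈ Q, U.conjTranspose.mulVec v q * U p q else 0 := by
  rw [proj, ← Matrix.mulVec_mulVec, ← Matrix.mulVec_mulVec, ← Matrix.mulVec_mulVec, diagProj,
    diagProj, Matrix.mulVec_diagonal]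
  split_ifs with h
  · rw [one_mul]
    simp only [Matrix.mulVec, dotProduct, Matrix.diagonal_apply, ite_mul, one_mul, zero_mul,
      mul_ite, mul_zero, sum_ite_eq, mem_univ, if_true, sum_ite_mem, univ_inter]
    exact sum_congr rfl fun q _ => mul_comm _ _
  · rw [zero_mul]

/-- Reduction modulo `m` does not affect the character, and the offset `l + 1` contributes a phase
independent of `k`. -/
theorem norm_sum_circInterval_mul_dft {m l n : ℕ} (hm : 0 < m) (hn : n ≤ m) (y : Idx m → ℂ)
    (p : Idx m) :
    ‖∑ q ∈ circInterval m l n, y q * dft m p q‖ ^ 2 = 1 / m * ‖∑ k ∈ range n,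
      y ⟨(l + k) % m + 1, mem_Icc.2 ⟨by omega, Nat.mod_lt _ hm⟩⟩ *
        negChar (k * (p : ℕ) / m)‖ ^ 2 := by
  have hm' : (m : ℝ) ≠ 0 := by exact_mod_cast hm.ne'
  rw [circInterval_eq_image hm, sum_image (injOn_circular hm hn)]
  have hterm : ∀ k, dft m p ⟨(l + k) % m + 1, mem_Icc.2 ⟨by omega, Nat.mod_lt _ hm⟩⟩ =
      (1 / (Real.sqrt m : ℂ)) * negChar ((p : ℕ) * (l + 1) / m) * negChar (k * (p : ℕ) / m) := by
    intro k
    rw [dft_apply, mul_assoc, ← negChar_add]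
    congr 1
    have hdiv : ((l : ℝ) + k) = ((l + k) % m : ℕ) + m * ((l + k) / m : ℕ) := by
      exact_mod_cast (Nat.mod_add_div (l + k) m).symm
    have : ((p : ℕ) : ℝ) * (l + 1) / m + k * (p : ℕ) / m =
        (p : ℕ) * (((l + k) % m + 1 : ℕ) : ℝ) / m + (((p : ℕ) * ((l + k) / m) : ℕ) : ℝ) := by
      push_cast at hdiv ⊢
      field_simp
      linear_combination ((p : ℕ) : ℝ) * hdiv
    rw [this, negChar_add _ (((p : ℕ) * ((l + k) / m) : ℕ) : ℝ), negChar_natCast, mul_one]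
  simp only [hterm, mul_left_comm _ ((1 / (Real.sqrt m : ℂ)) * negChar ((p : ℕ) * (l + 1) / m))]
  rw [← mul_sum, norm_mul, norm_mul, norm_negChar, mul_one, mul_pow]
  congr 1
  rw [norm_div, norm_one, Complex.norm_real, Real.norm_of_nonneg (Real.sqrt_nonneg _), div_pow,
    one_pow, Real.sq_sqrt (Nat.cast_nonneg m)]

end LargeSieve

theorem mainTheorem3 (m : ℕ) (P : Finset (LargeSieve.Idx m)) (l n : ℕ)
    (hl : l ∈ Finset.Icc 1 m) (hn : n ∈ Finset.Icc 1 m)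
    (lam : ℝ) (hlam : lam ∈ Set.Ioc (0 : ℝ) m) :
    LargeSieve.Delta P (LargeSieve.circInterval m l n) (LargeSieve.dft m) ≤
      Real.sqrt ((lam * ((n : ℝ) - 1) / m + 1) * LargeSieve.nyquistDensity P lam) := by
  obtain ⟨hn1, hnm⟩ := Finset.mem_Icc.1 hn
  obtain ⟨hlam0, hlamm⟩ := hlam
  have hm : 0 < m := by omega
  have hm' : (0 : ℝ) < m := by exact_mod_cast hm
  have hn' : 0 ≤ (n : ℝ) - 1 := by
    have : (1 : ℝ) ≤ n := by exact_mod_cast hn1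
    linarith
  have hK0 : 0 ≤ (lam * ((n : ℝ) - 1) / m + 1) * LargeSieve.nyquistDensity P lam := by
    unfold LargeSieve.nyquistDensity
    positivity
  refine ContinuousLinearMap.opNorm_le_bound _ (Real.sqrt_nonneg _) fun v => ?_
  refine le_of_sq_le_sq ?_ (by positivity)
  rw [mul_pow, Real.sq_sqrt hK0, EuclideanSpace.norm_sq_eq, EuclideanSpace.norm_sq_eq,
    Matrix.ofLp_toEuclideanCLM, ← LargeSieve.sum_norm_sq_conjTranspose_dft_mulVec v.ofLp]
  set y := (LargeSieve.dft m).conjTranspose.mulVec v.ofLp with hy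
  set idx : ℕ → LargeSieve.Idx m := fun k =>
    ⟨(l + k) % m + 1, Finset.mem_Icc.2 ⟨by omega, Nat.mod_lt _ hm⟩⟩ with hidx
  calc ∑ p, ‖(LargeSieve.diagProj P *
        LargeSieve.proj (LargeSieve.circInterval m l n) (LargeSieve.dft m)).mulVec v.ofLp p‖ ^ 2
      = 1 / m * ∑ p ∈ P, ‖∑ k ∈ range n, y (idx k) * LargeSieve.negChar (k * (p : ℕ) / m)‖ ^ 2 := by
        have h : ∀ p, ‖(LargeSieve.diagProj P * LargeSieve.proj (LargeSieve.circInterval m l n)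
            (LargeSieve.dft m)).mulVec v.ofLp p‖ ^ 2 = if p ∈ P then 1 / m *
              ‖∑ k ∈ range n, y (idx k) * LargeSieve.negChar (k * (p : ℕ) / m)‖ ^ 2 else 0 := by
          intro p
          rw [LargeSieve.diagProj_mul_proj_mulVec]
          split_ifs with hp
          · exact LargeSieve.norm_sum_circInterval_mul_dft hm hnm y p
          · simp
        simp only [h, sum_ite_mem, univ_inter, ← mul_sum]
    _ ≤ 1 / m * (LargeSieve.maxOpenCount P lam * ((n : ℝ) - 1 + m / lam) *
          ∑ k ∈ range n, ‖y (idx k)‖ ^ 2) :=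
        mul_le_mul_of_nonneg_left
          (LargeSieve.sum_norm_sq_le_maxOpenCount P hm hn1 hlam0 hlamm fun k => y (idx k))
          (by positivity)
    _ ≤ 1 / m * (LargeSieve.maxOpenCount P lam * ((n : ℝ) - 1 + m / lam) * ∑ q, ‖y q‖ ^ 2) := by
        refine mul_le_mul_of_nonneg_left (mul_le_mul_of_nonneg_left ?_ (by positivity))
          (by positivity)
        rw [← sum_image (f := fun q => ‖y q‖ ^ 2) (LargeSieve.injOn_circular (l := l) hm hnm)]
        exact sum_le_sum_of_subset_of_nonneg (subset_univ _) fun _ _ _ => sq_nonneg _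
    -- `(N/m)(n - 1 + m/lam) = (lam (n - 1)/m + 1) (N/lam)`.
    _ = _ := by
        unfold LargeSieve.nyquistDensity
        field_simp
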